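/- Let $\mathfrak H$ be a complex Hilbert space with inner product $(\cdot,\cdot)$, let $J$ be a fundamental symmetry in $\mathfrak H$ (a bounded operator with $J=J^*$, $J^2=I$), and put $[x,y]=(Jx,y)$. Let $S$ be a closed densely defined symmetric operator in $\mathfrak H$ with $SJ=JS$. (Equalities such as $SJ=JS$ are equalities of unbounded operators, including the equality of their natural domains.) For $\mu\in\mathbb C\setminus\mathbb R$ let $\mathfrak N_\mu=\ker(S^*-\mu I)$. For $\mu\in\mathbb C_+=\{\mu:\operatorname{Im}\mu>0\}$ let $A_\mu$ be the restriction of $S^*$ to $\mathcal D(S)\dotplus\mathfrak N_\mu$, and let $$\mathsf{Sh}(\mu)=(A_\mu-iI)(A_\mu+iI)^{-1}\upharpoonright_{\mathfrak N_i}:\ \mathfrak N_i\to\mathfrak N_{-i}$$ be the characteristic function of $S$. Let $\mathfrak U$ be the set of all $C$-symmetries of $S$, i.e. of all bounded operators $C$ in $\mathfrak H$ with $C^2=I$, $JC>0$ (that is, $(JCx,x)>0$ for all $x\neq0$) and $SC=CS$. Let $\Upsilon_{\mathfrak U}$ be the set of all $J$-self-adjoint extensions $A\supset S$ (densely defined operators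 that contain $S$ and are equal to their adjoint with respect to $[\cdot,\cdot]$) such that $AC=CA$ for every $C\in\mathfrak U$. If there is a $\mu\in\mathbb C_+$ for which $\mathsf{Sh}(\mu)$ is boundedly invertible (a bounded bijection of $\mathfrak N_i$ onto $\mathfrak N_{-i}$ with bounded inverse), then $\Upsilon_{\mathfrak U}\neq\emptyset$. That is, there is a $J$-self-adjoint extension of $S$ that commutes with every $C$-symmetry of $S$. -/

import Mathlib

open scoped LinearPMap

noncomputable section

namespace KreinExt

variable {H : Type*} [NormedAddCommGroup H] [InnerProductSpace ℂ H]

/-! ### Generalities on unbounded operators -/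

/-- The composition `g f` of two unbounded operators on its natural domain
`{x ∈ D(f) | f x ∈ D(g)}`. -/
def pcomp (g f : H →ₗ.[ℂ] H) : H →ₗ.[ℂ] H :=
  g.comp (f.domRestrict ((g.domain.comap f.toFun).map f.domain.subtype)) (by
    rintro ⟨x, hx, hx'⟩
    obtain ⟨w, hw, rfl⟩ := hx
    exact hw)

/-- The operator `A - z I`, with domain `D(A)`. -/
def shift (A : H →ₗ.[ℂ] H) (z : ℂ) : H →ₗ.[ℂ] H :=
  (-(z • (LinearMap.id : H →ₗ[ℂ] H))) +ᵥ A

/-- `A C = C A` for an unbounded operator `A` and an everywhere defined bounded operator `C`,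
as an equality of unbounded operators: `D(AC) = {x | C x ∈ D(A)}` equals `D(CA) = D(A)`, and
`A C x = C A x` there. -/
def Commutes (A : H →ₗ.[ℂ] H) (C : H →L[ℂ] H) : Prop :=
  (∀ x : H, C x ∈ A.domain ↔ x ∈ A.domain) ∧
    ∀ (x : H) (hx : x ∈ A.domain) (hCx : C x ∈ A.domain), A ⟨C x, hCx⟩ = C (A ⟨x, hx⟩)

/-! ### Krein space notions -/

/-- `J` is a fundamental symmetry: `J = J*` and `J² = I`. -/
def IsFundamentalSymmetry [CompleteSpace H] (J : H →L[ℂ] H) : Prop :=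
  IsSelfAdjoint J ∧ J * J = 1

/-- The indefinite inner product `[x, y] = (J x, y)`, linear in the first variable `x` (Mathlib's
`inner ℂ a b` is linear in its second variable, so that the form `(a, b)` that is linear in the
first one is `inner ℂ b a`). -/
def krein (J : H →L[ℂ] H) (x y : H) : ℂ := inner ℂ y (J x)

/-- `A` is `J`-self-adjoint: `A` is densely defined and equals its adjoint with respect to
`[·,·]`, that is, `(y, z)` belongs to the graph of `A` if and only if `[A x, y] = [x, z]` for all
`x ∈ D(A)`. -/
def IsJSelfAdjoint (J : H →L[ℂ] H) (A : H →ₗ.[ℂ] H) : Prop :=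
  Dense (A.domain : Set H) ∧
    ∀ y z : H, (y, z) ∈ A.graph ↔ ∀ x : A.domain, krein J (A x) y = krein J (x : H) z

/-- The set `Σ_J` of all `J`-self-adjoint extensions of `S`. -/
def jSelfAdjointExtensions (J : H →L[ℂ] H) (S : H →ₗ.[ℂ] H) : Set (H →ₗ.[ℂ] H) :=
  {A | S ≤ A ∧ IsJSelfAdjoint J A}

/-- The set `𝔘` of all `C`-symmetries of `S`: the bounded operators `C` with `C² = I`, `J C > 0`
and `S C = C S`. -/
def cSymmetries (J : H →L[ℂ] H) (S : H →ₗ.[ℂ] H) : Set (H →L[ℂ] H) :=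
  {C | C * C = 1 ∧ ((J * C).IsPositive ∧ ∀ x : H, x ≠ 0 → 0 < (inner ℂ (J (C x)) x).re) ∧
    Commutes S C}

/-- The set `Υ_𝔘` of all `J`-self-adjoint extensions of `S` that commute with every
`C`-symmetry of `S`. -/
def upsilonU (J : H →L[ℂ] H) (S : H →ₗ.[ℂ] H) : Set (H →ₗ.[ℂ] H) :=
  {A | A ∈ jSelfAdjointExtensions J S ∧ ∀ C ∈ cSymmetries J S, Commutes A C}

/-! ### The characteristic function of a symmetric operator -/

variable [CompleteSpace H]

/-- The defect subspace `𝔑_μ = ker (S* - μ I)`. -/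
def defect (S : H →ₗ.[ℂ] H) (μ : ℂ) : Submodule ℂ H :=
  (LinearMap.ker (shift S† μ).toFun).map (shift S† μ).domain.subtype

/-- The extension `A_μ` of `S`: the restriction of `S*` to `D(S) ∔ 𝔑_μ`. -/
def dissExt (S : H →ₗ.[ℂ] H) (μ : ℂ) : H →ₗ.[ℂ] H :=
  S†.domRestrict (S.domain ⊔ defect S μ)

/-- The characteristic function `Sh(μ) = (A_μ - i I)(A_μ + i I)⁻¹ ↾ 𝔑_i`, `Im μ > 0`. -/
def charFun (S : H →ₗ.[ℂ] H) (μ : ℂ) : H →ₗ.[ℂ] H :=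
  (pcomp (shift (dissExt S μ) Complex.I) (shift (dissExt S μ) (-Complex.I)).inverse).domRestrict
    (defect S Complex.I)

/-- `Sh(μ) : 𝔑_i → 𝔑_{-i}` is boundedly invertible: it is a bounded bijection of `𝔑_i` onto
`𝔑_{-i}` with bounded inverse. -/
def CharFunBoundedlyInvertible (S : H →ₗ.[ℂ] H) (μ : ℂ) : Prop :=
  ∃ e : defect S Complex.I ≃L[ℂ] defect S (-Complex.I),
    ∀ x : defect S Complex.I, ((x : H), (e x : H)) ∈ (charFun S μ).graph

end KreinExt

end

/-!
The operator `A` is built from a unitary `U : 𝔑_i → 𝔑_{-i}` by von Neumann's formula: adjoin to `S`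
the vectors `n + U n` with `n ∈ 𝔑_i`. The resulting symmetric operator has trivial defect subspaces,
so its adjoint `A` is self-adjoint, and `A` commutes with every `C` for which `C` and `C*` commute
with `S` and with `U`. If `C` is a `C`-symmetry, then `J C > 0` gives `C* = J C J`, so `C*` commutes
with `S` as well; hence `C` and `C*` leave the defect subspaces invariant and commute with `Sh(μ)`.
The unitary `U = Sh(μ) (Sh(μ)* Sh(μ))^{-1/2}` of the polar decomposition therefore commutes with
all of them, and also with `J`, which makes `A` a `J`-self-adjoint operator.
-/

namespace KreinExt

open ContinuousLinearMap (adjoint)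
open scoped InnerProductSpace ComplexConjugate

section Polar

variable {K L : Type*} [NormedAddCommGroup K] [InnerProductSpace ℂ K] [CompleteSpace K]
  [NormedAddCommGroup L] [InnerProductSpace ℂ L] [CompleteSpace L]

theorem isStrictlyPositive_adjoint_comp_self (T : K ≃L[ℂ] L) :
    IsStrictlyPositive (adjoint (T : K →L[ℂ] L) ∘L (T : K →L[ℂ] L)) := by
  refine IsUnit.isStrictlyPositive ?_ ((ContinuousLinearMap.nonneg_iff_isPositive _).2
    (ContinuousLinearMap.isPositive_adjoint_comp_self _))
  have hright : (T : K →L[ℂ] L) ∘L (T.symm : L →L[ℂ] K) = .id ℂ L := T.coe_comp_coe_symm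
  have hleft : (T.symm : L →L[ℂ] K) ∘L (T : K →L[ℂ] L) = .id ℂ K := T.coe_symm_comp_coe
  refine isUnit_iff_exists.2 ⟨T.symm ∘L adjoint (T.symm : L →L[ℂ] K), ?_, ?_⟩
  · rw [ContinuousLinearMap.mul_def, ContinuousLinearMap.comp_assoc,
      ← ContinuousLinearMap.comp_assoc (T : K →L[ℂ] L), hright, ContinuousLinearMap.id_comp,
      ← ContinuousLinearMap.adjoint_comp, hleft, ContinuousLinearMap.adjoint_id]
    rfl
  · rw [ContinuousLinearMap.mul_def, ContinuousLinearMap.comp_assoc,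
      ← ContinuousLinearMap.comp_assoc (adjoint (T.symm : L →L[ℂ] K)),
      ← ContinuousLinearMap.adjoint_comp, hright, ContinuousLinearMap.adjoint_id,
      ContinuousLinearMap.id_comp, hleft]
    rfl

/-- The positive operator `(T* T)^{-1/2}` attached to an invertible operator `T`. -/
noncomputable def absInv (T : K ≃L[ℂ] L) : K →L[ℂ] K :=
  (adjoint (T : K →L[ℂ] L) ∘L (T : K →L[ℂ] L)) ^ (-(1 / 2) : ℝ)

theorem isUnit_absInv (T : K ≃L[ℂ] L) : IsUnit (absInv T) :=
  (isStrictlyPositive_adjoint_comp_self T).isUnit.cfcRpow _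
    (isStrictlyPositive_adjoint_comp_self T).nonneg

theorem inner_comp_absInv (T : K ≃L[ℂ] L) (x y : K) :
    ⟪T (absInv T x), T (absInv T y)⟫_ℂ = ⟪x, y⟫_ℂ := by
  have hself : adjoint (absInv T) = absInv T :=
    (IsSelfAdjoint.of_nonneg (CFC.rpow_nonneg : 0 ≤ absInv T)).star_eq
  have hone : absInv T * (adjoint (T : K →L[ℂ] L) ∘L (T : K →L[ℂ] L)) * absInv T = 1 :=
    CFC.conjugate_rpow_neg_one_half _ (isStrictlyPositive_adjoint_comp_self T)
  calc ⟪T (absInv T x), T (absInv T y)⟫_ℂ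
      = ⟪x, (absInv T * (adjoint (T : K →L[ℂ] L) ∘L (T : K →L[ℂ] L)) * absInv T) y⟫_ℂ := by
        rw [← T.coe_coe, ← ContinuousLinearMap.adjoint_inner_right,
          ← ContinuousLinearMap.adjoint_inner_right, hself]
        rfl
    _ = ⟪x, y⟫_ℂ := by rw [hone]; rfl

/-- The unitary factor `U = T (T* T)^{-1/2}` of the polar decomposition of an invertible
operator `T`. -/
noncomputable def unitaryFactor (T : K ≃L[ℂ] L) : K ≃ₗᵢ[ℂ] L :=
  .ofSurjective (((T : K →L[ℂ] L) ∘L absInv T).toLinearMap.isometryOfInner (inner_comp_absInv T))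
    (T.surjective.comp (ContinuousLinearMap.isUnit_iff_bijective.1 (isUnit_absInv T)).2)

theorem unitaryFactor_apply (T : K ≃L[ℂ] L) (x : K) : unitaryFactor T x = T (absInv T x) :=
  rfl

theorem unitaryFactor_map {T : K ≃L[ℂ] L} {a : K →L[ℂ] K} {b : L →L[ℂ] L}
    (hab : (T : K →L[ℂ] L) ∘L a = b ∘L T)
    (hab' : (T : K →L[ℂ] L) ∘L adjoint a = adjoint b ∘L T) (x : K) :
    unitaryFactor T (a x) = b (unitaryFactor T x) := by
  have hba : adjoint (T : K →L[ℂ] L) ∘L b = a ∘L adjoint (T : K →L[ℂ] L) := by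
    simpa only [ContinuousLinearMap.adjoint_comp, ContinuousLinearMap.adjoint_adjoint]
      using (congrArg adjoint hab').symm
  have hcomm : Commute (adjoint (T : K →L[ℂ] L) ∘L (T : K →L[ℂ] L)) a := by
    change (adjoint (T : K →L[ℂ] L) ∘L (T : K →L[ℂ] L)) ∘L a = a ∘L adjoint (T : K →L[ℂ] L) ∘L T
    rw [ContinuousLinearMap.comp_assoc, hab, ← ContinuousLinearMap.comp_assoc, hba,
      ContinuousLinearMap.comp_assoc]
  have habs : absInv T (a x) = a (absInv T x) :=
    DFunLike.congr_fun (hcomm.cfc_nnreal (· ^ (-(1 / 2) : ℝ))).eq x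
  rw [unitaryFactor_apply, unitaryFactor_apply, habs]
  exact DFunLike.congr_fun hab _

end Polar

section Graph

variable {R E F : Type*} [Ring R] [AddCommGroup E] [Module R E] [AddCommGroup F] [Module R F]

theorem mem_graph_domRestrict {A : E →ₗ.[R] F} {V : Submodule R E} {x : E} {y : F} :
    (x, y) ∈ (A.domRestrict V).graph ↔ x ∈ V ∧ (x, y) ∈ A.graph := by
  simp only [LinearPMap.mem_graph_iff]
  constructor
  · rintro ⟨w, rfl, rfl⟩
    exact ⟨w.2.1, ⟨w, w.2.2⟩, rfl, rfl⟩
  · rintro ⟨hx, w, rfl, rfl⟩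
    exact ⟨⟨w, hx, w.2⟩, rfl, rfl⟩

theorem mem_graph_inverse {A : E →ₗ.[R] F} (hA : A.toFun.ker = ⊥) {x : F} {y : E} :
    (x, y) ∈ A.inverse.graph ↔ (y, x) ∈ A.graph := by
  rw [LinearPMap.inverse_graph hA]
  exact Submodule.mem_map_equiv (e := LinearEquiv.prodComm R E F) _

end Graph

variable {H : Type*} [NormedAddCommGroup H] [InnerProductSpace ℂ H]

section Operations

variable {A B : H →ₗ.[ℂ] H} {x y : H}

theorem mem_graph_shift {z : ℂ} : (x, y) ∈ (shift A z).graph ↔ (x, y + z • x) ∈ A.graph := by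
  simp only [LinearPMap.mem_graph_iff]
  constructor
  · rintro ⟨w, rfl, rfl⟩
    refine ⟨w, rfl, ?_⟩
    change A w = -(z • (w : H)) + A w + z • (w : H)
    abel
  · rintro ⟨w, rfl, h⟩
    refine ⟨w, rfl, ?_⟩
    change -(z • (w : H)) + A w = y
    rw [h]
    abel

theorem mem_graph_pcomp :
    (x, y) ∈ (pcomp A B).graph ↔ ∃ w, (x, w) ∈ B.graph ∧ (w, y) ∈ A.graph := by
  constructor
  · intro h
    obtain ⟨⟨_, ⟨v, hv, rfl⟩, hw⟩, rfl, rfl⟩ := (LinearPMap.mem_graph_iff _).1 h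
    exact ⟨B v, B.mem_graph v, A.mem_graph ⟨B v, hv⟩⟩
  · rintro ⟨w, hxw, hwy⟩
    obtain ⟨v, rfl, rfl⟩ := (LinearPMap.mem_graph_iff _).1 hxw
    obtain ⟨⟨u, hu⟩, (rfl : u = B v), rfl⟩ := (LinearPMap.mem_graph_iff _).1 hwy
    exact (LinearPMap.mem_graph_iff _).2 ⟨⟨v, ⟨v, hu, rfl⟩, v.2⟩, rfl, rfl⟩

/-- The inclusion `C A ⊆ A C`, for a bounded operator `C` and an unbounded operator `A`. -/
def PreservesGraph (A : H →ₗ.[ℂ] H) (C : H →L[ℂ] H) : Prop :=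
  ∀ ⦃x y : H⦄, (x, y) ∈ A.graph → (C x, C y) ∈ A.graph

theorem PreservesGraph.mul {C D : H →L[ℂ] H} (hC : PreservesGraph A C) (hD : PreservesGraph A D) :
    PreservesGraph A (C * D) :=
  fun _ _ h => hC (hD h)

theorem commutes_iff_preservesGraph {C : H →L[ℂ] H} (hC : C * C = 1) :
    Commutes A C ↔ PreservesGraph A C := by
  constructor
  · intro h x y hxy
    obtain ⟨w, rfl, rfl⟩ := (LinearPMap.mem_graph_iff _).1 hxy
    have hw := (h.1 w).2 w.2
    exact (LinearPMap.mem_graph_iff _).2 ⟨⟨C w, hw⟩, rfl, h.2 w w.2 hw⟩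
  · intro h
    have map_mem {x : H} (hx : x ∈ A.domain) : C x ∈ A.domain :=
      LinearPMap.mem_domain_of_mem_graph (h (A.mem_graph ⟨x, hx⟩))
    refine ⟨fun x => ⟨fun hx => ?_, map_mem⟩, fun x hx hCx => ?_⟩
    · have := map_mem hx
      rwa [← mul_apply_eq_comp, hC] at this
    · exact A.mem_graph_snd_inj (A.mem_graph ⟨C x, hCx⟩) (h (A.mem_graph ⟨x, hx⟩)) rfl

end Operations

section Adjoint

variable {𝕜 E F : Type*} [RCLike 𝕜] [NormedAddCommGroup E] [InnerProductSpace 𝕜 E]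
  [NormedAddCommGroup F] [InnerProductSpace 𝕜 F]

theorem isFormalAdjoint_iff_graph {T : E →ₗ.[𝕜] F} {S : F →ₗ.[𝕜] E} :
    T.IsFormalAdjoint S ↔ ∀ ⦃x y⦄, (x, y) ∈ T.graph → ∀ ⦃s t⦄, (s, t) ∈ S.graph →
      ⟪y, s⟫_𝕜 = ⟪x, t⟫_𝕜 := by
  constructor
  · intro h x y hxy s t hst
    obtain ⟨w, rfl, rfl⟩ := (LinearPMap.mem_graph_iff _).1 hxy
    obtain ⟨v, rfl, rfl⟩ := (LinearPMap.mem_graph_iff _).1 hst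
    exact h w v
  · exact fun h x y => h (T.mem_graph x) (S.mem_graph y)

variable [CompleteSpace E] {T T' : E →ₗ.[𝕜] F}

theorem mem_graph_adjoint (hT : Dense (T.domain : Set E)) {x : F} {y : E} :
    (x, y) ∈ T†.graph ↔ ∀ ⦃s t⦄, (s, t) ∈ T.graph → ⟪y, s⟫_𝕜 = ⟪x, t⟫_𝕜 := by
  rw [LinearPMap.adjoint_graph_eq_graph_adjoint hT, Submodule.mem_adjoint_iff]
  refine forall₃_congr fun s t _ => ?_
  rw [sub_eq_zero, ← inner_conj_symm, ← inner_conj_symm s, (starRingEnd 𝕜).injective.eq_iff,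
    eq_comm]

theorem adjoint_le_adjoint (hT : Dense (T.domain : Set E)) (h : T ≤ T') : T'† ≤ T† := by
  refine LinearPMap.le_of_le_graph ?_
  rintro ⟨x, y⟩ hxy
  rw [mem_graph_adjoint (hT.mono h.1)] at hxy
  exact (mem_graph_adjoint hT).2 fun s t hst => hxy (LinearPMap.le_graph_of_le h hst)

end Adjoint

section Symmetric

variable {S : H →ₗ.[ℂ] H}

theorem im_inner_smul_self (z : ℂ) (x : H) : (⟪x, z • x⟫_ℂ).im = z.im * ‖x‖ ^ 2 := by
  rw [inner_smul_right, inner_self_eq_norm_sq_to_K]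
  simp [← Complex.ofReal_pow]

theorem im_inner_eq_zero_of_mem_graph (hs : S.IsFormalAdjoint S) {s t : H}
    (h : (s, t) ∈ S.graph) : (⟪s, t⟫_ℂ).im = 0 := by
  rw [← Complex.conj_eq_iff_im, inner_conj_symm]
  exact isFormalAdjoint_iff_graph.1 hs h h

theorem im_inner_eq_zero_of_mem_topologicalClosure_graph (hs : S.IsFormalAdjoint S) {p : H × H}
    (hp : p ∈ S.graph.topologicalClosure) : (⟪p.1, p.2⟫_ℂ).im = 0 := by
  have hclosed : IsClosed {p : H × H | (⟪p.1, p.2⟫_ℂ).im = 0} :=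
    isClosed_eq (by fun_prop) continuous_const
  exact closure_minimal (fun _ hq => im_inner_eq_zero_of_mem_graph hs hq) hclosed hp

theorem abs_im_mul_norm_le_norm_sub_smul {s t : H} (h : (⟪s, t⟫_ℂ).im = 0) (z : ℂ) :
    |z.im| * ‖s‖ ≤ ‖t - z • s‖ := by
  have him : (⟪s, t - z • s⟫_ℂ).im = -(z.im * ‖s‖ ^ 2) := by
    rw [inner_sub_right, Complex.sub_im, h, im_inner_smul_self, zero_sub]
  have hcs : |z.im| * ‖s‖ ^ 2 ≤ ‖s‖ * ‖t - z • s‖ := by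
    calc |z.im| * ‖s‖ ^ 2 = |(⟪s, t - z • s⟫_ℂ).im| := by rw [him, abs_neg, abs_mul, abs_sq]
      _ ≤ ‖s‖ * ‖t - z • s‖ := (Complex.abs_im_le_norm _).trans (norm_inner_le_norm _ _)
  rcases (norm_nonneg s).eq_or_lt with h0 | hpos
  · simp [← h0]
  · exact le_of_mul_le_mul_left (by linarith) hpos

theorem norm_prod_le_mul_norm_sub_smul {s t : H} (h : (⟪s, t⟫_ℂ).im = 0) {z : ℂ}
    (hz : z.im ≠ 0) : ‖(s, t)‖ ≤ (1 + (1 + ‖z‖) / |z.im|) * ‖t - z • s‖ := by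
  have hs : ‖s‖ ≤ ‖t - z • s‖ / |z.im| := by
    rw [le_div_iff₀' (abs_pos.2 hz)]
    exact abs_im_mul_norm_le_norm_sub_smul h z
  have ht : ‖t‖ ≤ ‖t - z • s‖ + ‖z‖ * ‖s‖ := by
    simpa only [sub_add_cancel, norm_smul] using norm_add_le (t - z • s) (z • s)
  have hconst : (1 + (1 + ‖z‖) / |z.im|) * ‖t - z • s‖ =
      ‖t - z • s‖ + ‖t - z • s‖ / |z.im| + ‖z‖ * (‖t - z • s‖ / |z.im|) := by ring
  rw [hconst]
  refine max_le (hs.trans ?_) (ht.trans ?_)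
  · linarith [norm_nonneg (t - z • s), mul_nonneg (norm_nonneg z) ((norm_nonneg s).trans hs)]
  · linarith [mul_le_mul_of_nonneg_left hs (norm_nonneg z), (norm_nonneg s).trans hs]

end Symmetric

variable [CompleteSpace H] {S : H →ₗ.[ℂ] H}

section Defect

theorem mem_defect {μ : ℂ} {x : H} : x ∈ defect S μ ↔ (x, μ • x) ∈ S†.graph := by
  have hker : x ∈ defect S μ ↔ (x, (0 : H)) ∈ (shift S† μ).graph := by
    rw [LinearPMap.mem_graph_iff]
    exact ⟨fun ⟨w, hw, hx⟩ => ⟨w, hx, hw⟩, fun ⟨w, hx, hw⟩ => ⟨w, hw, hx⟩⟩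
  rw [hker, mem_graph_shift, zero_add]

theorem defect_eq_orthogonal (hd : Dense (S.domain : Set H)) (μ : ℂ) :
    defect S μ = (S.graph.map (LinearMap.snd ℂ H H - conj μ • LinearMap.fst ℂ H H))ᗮ := by
  ext x
  rw [mem_defect, mem_graph_adjoint hd, Submodule.mem_orthogonal']
  simp only [Submodule.mem_map, Prod.exists, LinearMap.sub_apply, LinearMap.smul_apply,
    LinearMap.fst_apply, LinearMap.snd_apply, forall_exists_index, and_imp]
  have key (s t : H) : ⟪μ • x, s⟫_ℂ = ⟪x, t⟫_ℂ ↔ ⟪x, t - conj μ • s⟫_ℂ = 0 := by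
    rw [inner_sub_right, inner_smul_left, inner_smul_right, sub_eq_zero, eq_comm]
  simp only [key]
  exact ⟨fun h _ s t hst hv => hv ▸ h hst, fun h s t hst => h _ s t hst rfl⟩

theorem defect_anti {T : H →ₗ.[ℂ] H} (hd : Dense (S.domain : Set H)) (h : S ≤ T) (μ : ℂ) :
    defect T μ ≤ defect S μ := fun _ hx =>
  mem_defect.2 (LinearPMap.le_graph_of_le (adjoint_le_adjoint hd h) (mem_defect.1 hx))

theorem isClosed_defect (hd : Dense (S.domain : Set H)) (μ : ℂ) :
    IsClosed (defect S μ : Set H) := by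
  rw [defect_eq_orthogonal hd]
  exact Submodule.isClosed_orthogonal _

end Defect

section SelfAdjoint

theorem exists_mem_topologicalClosure_graph_sub_smul_eq (hd : Dense (S.domain : Set H))
    (hs : S.IsFormalAdjoint S) {z : ℂ} (hz : z.im ≠ 0) (hdef : defect S (conj z) = ⊥) (v : H) :
    ∃ s t, (s, t) ∈ S.graph.topologicalClosure ∧ t - z • s = v := by
  let L : S.graph.topologicalClosure →L[ℂ] H :=
    (ContinuousLinearMap.snd ℂ H H - z • ContinuousLinearMap.fst ℂ H H) ∘L
      S.graph.topologicalClosure.subtypeL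
  have hdense : L.range.topologicalClosure = ⊤ := by
    rw [Submodule.topologicalClosure_eq_top_iff, eq_bot_iff, ← hdef, defect_eq_orthogonal hd,
      Complex.conj_conj]
    refine Submodule.orthogonal_le ?_
    rintro _ ⟨p, hp, rfl⟩
    exact ⟨⟨p, S.graph.le_topologicalClosure hp⟩, rfl⟩
  have hanti : AntilipschitzWith ⟨1 + (1 + ‖z‖) / |z.im|, by positivity⟩ L :=
    L.antilipschitz_of_bound fun p => norm_prod_le_mul_norm_sub_smul
      (im_inner_eq_zero_of_mem_topologicalClosure_graph hs p.2) hz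
  obtain ⟨⟨⟨s, t⟩, hst⟩, h⟩ :=
    (L.bijective_iff_dense_range_and_antilipschitz.2 ⟨hdense, _, hanti⟩).2 v
  exact ⟨s, t, hst, h⟩

theorem topologicalClosure_graph_le_graph_adjoint (hd : Dense (S.domain : Set H))
    (hs : S.IsFormalAdjoint S) : S.graph.topologicalClosure ≤ S†.graph :=
  Submodule.topologicalClosure_minimal _ (LinearPMap.le_graph_of_le (hs.le_adjoint hd))
    (LinearPMap.adjoint_isClosed hd)

theorem graph_adjoint_le_topologicalClosure_graph (hd : Dense (S.domain : Set H))
    (hs : S.IsFormalAdjoint S) {z : ℂ} (hz : z.im ≠ 0) (hdef : defect S z = ⊥)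
    (hdef' : defect S (conj z) = ⊥) : S†.graph ≤ S.graph.topologicalClosure := by
  rintro ⟨x, y⟩ hxy
  obtain ⟨s, t, hst, h⟩ :=
    exists_mem_topologicalClosure_graph_sub_smul_eq hd hs hz hdef' (y - z • x)
  have hsub : y - t = z • (x - s) := by
    rw [smul_sub, sub_eq_sub_iff_sub_eq_sub, h]
  have hmem : x - s ∈ defect S z := by
    rw [mem_defect, ← hsub]
    exact sub_mem hxy (topologicalClosure_graph_le_graph_adjoint hd hs hst)
  rw [hdef, Submodule.mem_bot, sub_eq_zero] at hmem
  rw [hmem, sub_self, smul_zero, sub_eq_zero] at hsub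
  rwa [hmem, hsub]

theorem isSelfAdjoint_adjoint_of_defect_eq_bot (hd : Dense (S.domain : Set H))
    (hs : S.IsFormalAdjoint S) {z : ℂ} (hz : z.im ≠ 0) (hdef : defect S z = ⊥)
    (hdef' : defect S (conj z) = ⊥) : IsSelfAdjoint S† := by
  have hle : S ≤ S† := hs.le_adjoint hd
  have hsymm : S†.IsFormalAdjoint S† := by
    refine isFormalAdjoint_iff_graph.2 fun x y hxy s t hst => ?_
    have hclosed : IsClosed {p : H × H | ⟪y, p.1⟫_ℂ = ⟪x, p.2⟫_ℂ} :=
      isClosed_eq (by fun_prop) (by fun_prop)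
    exact closure_minimal (fun p hp => (mem_graph_adjoint hd).1 hxy hp) hclosed
      (graph_adjoint_le_topologicalClosure_graph hd hs hz hdef hdef' hst)
  exact le_antisymm (adjoint_le_adjoint hd hle) (hsymm.le_adjoint (hd.mono hle.1))

theorem isJSelfAdjoint_of_isSelfAdjoint {J : H →L[ℂ] H} {A : H →ₗ.[ℂ] H} (hJ : J * J = 1)
    (hA : IsSelfAdjoint A) (hJA : PreservesGraph A J) : IsJSelfAdjoint J A := by
  have hJJ (x : H) : J (J x) = x := DFunLike.congr_fun hJ x
  refine ⟨hA.dense_domain, fun y z => ?_⟩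
  have hgraph : (y, z) ∈ A.graph ↔ ∀ ⦃s t⦄, (s, t) ∈ A.graph → ⟪z, s⟫_ℂ = ⟪y, t⟫_ℂ := by
    rw [← mem_graph_adjoint hA.dense_domain, LinearPMap.isSelfAdjoint_def.1 hA]
  rw [hgraph]
  constructor
  · exact fun h x => (h (hJA (A.mem_graph x))).symm
  · intro h s t hst
    obtain ⟨w, hw, hw'⟩ := (LinearPMap.mem_graph_iff _).1 (hJA hst)
    have := h w
    rw [hw, hw', krein, krein, hJJ, hJJ] at this
    exact this.symm

end SelfAdjoint

section VonNeumann

variable {z w : ℂ}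

/-- The extension of a symmetric operator `S` that von Neumann's formula attaches to a unitary
operator `U` between two defect subspaces: the restriction of `S*` to the vectors `s + n + U n`
with `s ∈ D(S)` and `n ∈ 𝔑_z`. -/
noncomputable def vonNeumannExt (S : H →ₗ.[ℂ] H) (U : defect S z ≃ₗᵢ[ℂ] defect S w) : H →ₗ.[ℂ] H :=
  S†.domRestrict (S.domain ⊔ LinearMap.range
    ((defect S z).subtype + (defect S w).subtype ∘ₗ U.toLinearEquiv.toLinearMap))

variable {U : defect S z ≃ₗᵢ[ℂ] defect S w}

theorem mem_graph_vonNeumannExt (hd : Dense (S.domain : Set H)) (hs : S.IsFormalAdjoint S)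
    {x y : H} : (x, y) ∈ (vonNeumannExt S U).graph ↔ ∃ s t, (s, t) ∈ S.graph ∧ ∃ n : defect S z,
      x = s + (n + U n) ∧ y = t + (z • (n : H) + w • (U n : H)) := by
  have mem_adjoint {s t : H} (hst : (s, t) ∈ S.graph) (n : defect S z) :
      (s + (n + U n), t + (z • (n : H) + w • (U n : H))) ∈ S†.graph :=
    add_mem (LinearPMap.le_graph_of_le (hs.le_adjoint hd) hst)
      (add_mem (mem_defect.1 n.2) (mem_defect.1 (U n).2))
  rw [vonNeumannExt, mem_graph_domRestrict]
  constructor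
  · rintro ⟨hx, hxy⟩
    obtain ⟨s, hs, _, ⟨n, rfl⟩, rfl⟩ := Submodule.mem_sup.1 hx
    have hst := S.mem_graph ⟨s, hs⟩
    exact ⟨s, _, hst, n, rfl, S†.mem_graph_snd_inj hxy (mem_adjoint hst n) rfl⟩
  · rintro ⟨s, t, hst, n, rfl, rfl⟩
    exact ⟨Submodule.add_mem_sup (LinearPMap.mem_domain_of_mem_graph hst) ⟨n, rfl⟩,
      mem_adjoint hst n⟩

theorem le_vonNeumannExt (hd : Dense (S.domain : Set H)) (hs : S.IsFormalAdjoint S) :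
    S ≤ vonNeumannExt S U := by
  refine LinearPMap.le_of_le_graph ?_
  rintro ⟨s, t⟩ hst
  exact (mem_graph_vonNeumannExt hd hs).2 ⟨s, t, hst, 0, by simp, by simp⟩

theorem isFormalAdjoint_vonNeumannExt (hd : Dense (S.domain : Set H)) (hs : S.IsFormalAdjoint S)
    (hw : w = conj z) : (vonNeumannExt S U).IsFormalAdjoint (vonNeumannExt S U) := by
  refine isFormalAdjoint_iff_graph.2 fun x y hxy x' y' hxy' => ?_
  obtain ⟨s, t, hst, n, rfl, rfl⟩ := (mem_graph_vonNeumannExt hd hs).1 hxy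
  obtain ⟨s', t', hst', n', rfl, rfl⟩ := (mem_graph_vonNeumannExt hd hs).1 hxy'
  have hSS : ⟪t, s'⟫_ℂ = ⟪s, t'⟫_ℂ := isFormalAdjoint_iff_graph.1 hs hst hst'
  have hNS {s t : H} (hst : (s, t) ∈ S.graph) (n : defect S z) :
      ⟪z • (n : H) + w • (U n : H), s⟫_ℂ = ⟪(n : H) + U n, t⟫_ℂ :=
    (mem_graph_adjoint hd).1 (add_mem (mem_defect.1 n.2) (mem_defect.1 (U n).2)) hst
  have hSN : ⟪t, n' + U n'⟫_ℂ = ⟪s, z • (n' : H) + w • (U n' : H)⟫_ℂ := by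
    rw [← inner_conj_symm, ← hNS hst n', inner_conj_symm]
  have hNN : ⟪z • (n : H) + w • (U n : H), n' + U n'⟫_ℂ =
      ⟪(n : H) + U n, z • (n' : H) + w • (U n' : H)⟫_ℂ := by
    have hU : ⟪(U n : H), U n'⟫_ℂ = ⟪(n : H), n'⟫_ℂ := U.inner_map_map n n'
    simp only [inner_smul_left, inner_smul_right, inner_add_left, inner_add_right, hw,
      Complex.conj_conj, hU]
    ring
  rw [inner_add_left t, inner_add_left s, inner_add_right t, inner_add_right s,
    inner_add_right (z • _ + _), inner_add_right (_ + _) t', hSS, hSN, hNS hst', hNN]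

theorem inner_smul_eq_of_mem_defect_vonNeumannExt (hd : Dense (S.domain : Set H))
    (hs : S.IsFormalAdjoint S) {ζ : ℂ} {x : H} (hx : x ∈ defect (vonNeumannExt S U) ζ)
    (n : defect S z) : ⟪ζ • x, n + U n⟫_ℂ = ⟪x, z • (n : H) + w • (U n : H)⟫_ℂ :=
  (mem_graph_adjoint (hd.mono (le_vonNeumannExt hd hs).1)).1 (mem_defect.1 hx)
    ((mem_graph_vonNeumannExt hd hs).2 ⟨0, 0, zero_mem _, n, by rw [zero_add], by rw [zero_add]⟩)

theorem defect_vonNeumannExt_left_eq_bot (hd : Dense (S.domain : Set H))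
    (hs : S.IsFormalAdjoint S) (hw : w = conj z) (hz : z.im ≠ 0) :
    defect (vonNeumannExt S U) z = ⊥ := by
  subst hw
  refine (Submodule.eq_bot_iff _).2 fun x hx => ?_
  lift x to defect S z using defect_anti hd (le_vonNeumannExt hd hs) z hx
  have h := inner_smul_eq_of_mem_defect_vonNeumannExt hd hs hx x
  rw [inner_smul_left, inner_add_right, inner_add_right, inner_smul_right, inner_smul_right,
    mul_add, add_left_inj, mul_eq_mul_right_iff, Complex.conj_eq_iff_im] at h
  exact inner_self_eq_zero.1 (h.resolve_left hz)

theorem defect_vonNeumannExt_right_eq_bot (hd : Dense (S.domain : Set H))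
    (hs : S.IsFormalAdjoint S) (hw : w = conj z) (hz : z.im ≠ 0) :
    defect (vonNeumannExt S U) w = ⊥ := by
  subst hw
  refine (Submodule.eq_bot_iff _).2 fun x hx => ?_
  lift x to defect S (conj z) using defect_anti hd (le_vonNeumannExt hd hs) _ hx
  obtain ⟨n, rfl⟩ := U.surjective x
  have h := inner_smul_eq_of_mem_defect_vonNeumannExt hd hs hx n
  rw [inner_smul_left, inner_add_right, inner_add_right, inner_smul_right, inner_smul_right,
    Complex.conj_conj, mul_add, add_right_inj, mul_eq_mul_right_iff, eq_comm,
    Complex.conj_eq_iff_im] at h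
  exact inner_self_eq_zero.1 (h.resolve_left hz)

theorem isSelfAdjoint_adjoint_vonNeumannExt (hd : Dense (S.domain : Set H))
    (hs : S.IsFormalAdjoint S) (hw : w = conj z) (hz : z.im ≠ 0) :
    IsSelfAdjoint (vonNeumannExt S U)† :=
  isSelfAdjoint_adjoint_of_defect_eq_bot (hd.mono (le_vonNeumannExt hd hs).1)
    (isFormalAdjoint_vonNeumannExt hd hs hw) hz (defect_vonNeumannExt_left_eq_bot hd hs hw hz)
    (hw ▸ defect_vonNeumannExt_right_eq_bot hd hs hw hz)

theorem preservesGraph_vonNeumannExt (hd : Dense (S.domain : Set H)) (hs : S.IsFormalAdjoint S)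
    {C : H →L[ℂ] H} (hC : PreservesGraph S C)
    (hU : ∀ n : defect S z, ∃ m : defect S z, (m : H) = C n ∧ (U m : H) = C (U n)) :
    PreservesGraph (vonNeumannExt S U) C := by
  intro x y hxy
  obtain ⟨s, t, hst, n, rfl, rfl⟩ := (mem_graph_vonNeumannExt hd hs).1 hxy
  obtain ⟨m, hm, hUm⟩ := hU n
  refine (mem_graph_vonNeumannExt hd hs).2 ⟨C s, C t, hC hst, m, ?_, ?_⟩ <;>
    simp only [map_add, map_smul, hm, hUm]

end VonNeumann

section Commutant

/-- The bounded operators `C` such that both `C` and `C*` commute with `A`, in the sense that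
`C A ⊆ A C` and `C* A ⊆ A C*`. -/
def starCommutant (A : H →ₗ.[ℂ] H) : Set (H →L[ℂ] H) :=
  {C | PreservesGraph A C ∧ PreservesGraph A (adjoint C)}

variable {C : H →L[ℂ] H} {μ : ℂ}

theorem adjoint_mem_starCommutant (hC : C ∈ starCommutant S) : adjoint C ∈ starCommutant S :=
  ⟨hC.2, by simpa only [ContinuousLinearMap.adjoint_adjoint] using hC.1⟩

theorem preservesGraph_adjoint (hd : Dense (S.domain : Set H))
    (hC : PreservesGraph S (adjoint C)) : PreservesGraph S† C := by
  intro x y hxy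
  rw [mem_graph_adjoint hd] at hxy ⊢
  intro s t hst
  simpa only [ContinuousLinearMap.adjoint_inner_right] using hxy (hC hst)

theorem map_mem_defect (hd : Dense (S.domain : Set H)) (hC : PreservesGraph S (adjoint C)) :
    ∀ x ∈ defect S μ, C x ∈ defect S μ := by
  intro x hx
  rw [mem_defect] at hx ⊢
  simpa only [map_smul] using preservesGraph_adjoint hd hC hx

theorem adjoint_restrict {V : Submodule ℂ H} [CompleteSpace V] (h : ∀ x ∈ V, C x ∈ V)
    (h' : ∀ x ∈ V, adjoint C x ∈ V) : adjoint (C.restrict h) = (adjoint C).restrict h' := by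
  symm
  rw [ContinuousLinearMap.eq_adjoint_iff]
  exact fun x y => ContinuousLinearMap.adjoint_inner_left C (y : H) (x : H)

end Commutant

section CharFun

variable {μ : ℂ}

theorem im_inner_nonneg_of_mem_graph_dissExt (hd : Dense (S.domain : Set H))
    (hs : S.IsFormalAdjoint S) (hμ : 0 ≤ μ.im) {x y : H} (h : (x, y) ∈ (dissExt S μ).graph) :
    0 ≤ (⟪x, y⟫_ℂ).im := by
  obtain ⟨hx, hxy⟩ := mem_graph_domRestrict.1 h
  obtain ⟨s, hsd, n, hn, rfl⟩ := Submodule.mem_sup.1 hx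
  have hst := S.mem_graph ⟨s, hsd⟩
  set t := S ⟨s, hsd⟩
  have hn' := mem_defect.1 hn
  obtain rfl : y = t + μ • n :=
    S†.mem_graph_snd_inj hxy (add_mem (LinearPMap.le_graph_of_le (hs.le_adjoint hd) hst) hn') rfl
  have hcross : (⟪s, μ • n⟫_ℂ).im = -(⟪n, t⟫_ℂ).im := by
    rw [← (mem_graph_adjoint hd).1 hn' hst, ← inner_conj_symm, Complex.conj_im]
  have him : (⟪s + n, t + μ • n⟫_ℂ).im = μ.im * ‖n‖ ^ 2 := by
    have hnn : (⟪n, μ • n⟫_ℂ).im = μ.im * ‖n‖ ^ 2 := im_inner_smul_self μ n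
    rw [inner_add_left, inner_add_right, inner_add_right, Complex.add_im, Complex.add_im,
      Complex.add_im, im_inner_eq_zero_of_mem_graph hs hst, hcross, hnn]
    ring
  rw [him]
  positivity

theorem ker_shift_dissExt (hd : Dense (S.domain : Set H)) (hs : S.IsFormalAdjoint S)
    (hμ : 0 ≤ μ.im) {z : ℂ} (hz : z.im < 0) : (shift (dissExt S μ) z).toFun.ker = ⊥ := by
  refine LinearMap.ker_eq_bot'.2 fun x hx => Subtype.ext ?_
  have hgraph : ((x : H), z • (x : H)) ∈ (dissExt S μ).graph := by
    simpa only [zero_add] using mem_graph_shift.1 ((LinearPMap.mem_graph_iff _).2 ⟨x, rfl, hx⟩)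
  have him := im_inner_nonneg_of_mem_graph_dissExt hd hs hμ hgraph
  rw [im_inner_smul_self] at him
  have hx0 : ‖(x : H)‖ ^ 2 ≤ 0 := nonpos_of_mul_nonneg_right him hz
  exact norm_eq_zero.1 (pow_eq_zero_iff two_ne_zero |>.1 (hx0.antisymm (sq_nonneg _)))

theorem mem_graph_charFun (hd : Dense (S.domain : Set H)) (hs : S.IsFormalAdjoint S)
    (hμ : 0 ≤ μ.im) {x y : H} : (x, y) ∈ (charFun S μ).graph ↔ x ∈ defect S Complex.I ∧
      ∃ u v, (u, v) ∈ (dissExt S μ).graph ∧ x = v + Complex.I • u ∧ y = v - Complex.I • u := by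
  rw [charFun, mem_graph_domRestrict, mem_graph_pcomp]
  simp only [mem_graph_inverse (ker_shift_dissExt hd hs hμ (z := -Complex.I) (by simp)),
    mem_graph_shift]
  refine and_congr_right fun _ => exists_congr fun u => ⟨?_, ?_⟩
  · rintro ⟨hx, hy⟩
    have hxy := (dissExt S μ).mem_graph_snd_inj hx hy rfl
    refine ⟨_, hx, by module, ?_⟩
    rw [hxy]
    module
  · rintro ⟨v, huv, rfl, rfl⟩
    constructor <;> convert huv using 2 <;> module

theorem preservesGraph_dissExt (hd : Dense (S.domain : Set H)) {C : H →L[ℂ] H}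
    (hC : C ∈ starCommutant S) : PreservesGraph (dissExt S μ) C := by
  intro x y hxy
  obtain ⟨hx, hxy⟩ := mem_graph_domRestrict.1 hxy
  refine mem_graph_domRestrict.2 ⟨?_, preservesGraph_adjoint hd hC.2 hxy⟩
  obtain ⟨s, hs, n, hn, rfl⟩ := Submodule.mem_sup.1 hx
  rw [map_add]
  exact Submodule.add_mem_sup
    (LinearPMap.mem_domain_of_mem_graph (hC.1 (S.mem_graph ⟨s, hs⟩))) (map_mem_defect hd hC.2 n hn)

theorem preservesGraph_charFun (hd : Dense (S.domain : Set H)) (hs : S.IsFormalAdjoint S)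
    (hμ : 0 ≤ μ.im) {C : H →L[ℂ] H} (hC : C ∈ starCommutant S) :
    PreservesGraph (charFun S μ) C := by
  intro x y hxy
  obtain ⟨hx, u, v, huv, rfl, rfl⟩ := (mem_graph_charFun hd hs hμ).1 hxy
  exact (mem_graph_charFun hd hs hμ).2 ⟨map_mem_defect hd hC.2 _ hx, C u, C v,
    preservesGraph_dissExt hd hC huv, by simp only [map_add, map_smul],
    by simp only [map_sub, map_smul]⟩

theorem charFunEquiv_comp_restrict (hd : Dense (S.domain : Set H)) (hs : S.IsFormalAdjoint S)
    (hμ : 0 ≤ μ.im) {e : defect S Complex.I ≃L[ℂ] defect S (-Complex.I)}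
    (he : ∀ x : defect S Complex.I, ((x : H), (e x : H)) ∈ (charFun S μ).graph)
    {C : H →L[ℂ] H} (hC : C ∈ starCommutant S) :
    (e : defect S Complex.I →L[ℂ] defect S (-Complex.I)) ∘L C.restrict (map_mem_defect hd hC.2) =
      C.restrict (map_mem_defect hd hC.2) ∘L e := by
  ext x
  exact (charFun S μ).mem_graph_snd_inj (he (C.restrict (map_mem_defect hd hC.2) x))
    (preservesGraph_charFun hd hs hμ hC (he x)) rfl

theorem exists_linearIsometryEquiv_defect (hd : Dense (S.domain : Set H))
    (hs : S.IsFormalAdjoint S) (hμ : 0 ≤ μ.im) (hSh : CharFunBoundedlyInvertible S μ) :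
    ∃ U : defect S Complex.I ≃ₗᵢ[ℂ] defect S (-Complex.I), ∀ C ∈ starCommutant S,
      ∀ n : defect S Complex.I, ∃ m : defect S Complex.I, (m : H) = C n ∧ (U m : H) = C (U n) := by
  obtain ⟨e, he⟩ := hSh
  have hcomplete (z : ℂ) : CompleteSpace (defect S z) :=
    (isClosed_defect hd z).completeSpace_coe
  refine ⟨unitaryFactor e, fun C hC n => ⟨C.restrict (map_mem_defect hd hC.2) n, rfl, ?_⟩⟩
  have hC' := adjoint_mem_starCommutant hC
  have he' := charFunEquiv_comp_restrict hd hs hμ he hC'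
  rw [← adjoint_restrict (map_mem_defect hd hC.2), ← adjoint_restrict (map_mem_defect hd hC.2)]
    at he'
  exact congrArg Subtype.val
    (unitaryFactor_map (charFunEquiv_comp_restrict hd hs hμ he hC) he' n)

theorem exists_isSelfAdjoint_extension (hd : Dense (S.domain : Set H)) (hs : S.IsFormalAdjoint S)
    (hμ : 0 ≤ μ.im) (hSh : CharFunBoundedlyInvertible S μ) :
    ∃ A, S ≤ A ∧ IsSelfAdjoint A ∧ ∀ C ∈ starCommutant S, PreservesGraph A C := by
  obtain ⟨U, hU⟩ := exists_linearIsometryEquiv_defect hd hs hμ hSh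
  have hI : -Complex.I = conj Complex.I := Complex.conj_I.symm
  have hle : S ≤ vonNeumannExt S U := le_vonNeumannExt hd hs
  have hd' : Dense ((vonNeumannExt S U).domain : Set H) := hd.mono hle.1
  refine ⟨(vonNeumannExt S U)†,
    hle.trans ((isFormalAdjoint_vonNeumannExt hd hs hI).le_adjoint hd'),
    isSelfAdjoint_adjoint_vonNeumannExt hd hs hI (by simp), fun C hC => ?_⟩
  exact preservesGraph_adjoint hd'
    (preservesGraph_vonNeumannExt hd hs hC.2 (hU _ (adjoint_mem_starCommutant hC)))

end CharFun

section Krein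

variable {J C : H →L[ℂ] H}

theorem fundamentalSymmetry_mem_starCommutant (hJ : IsFundamentalSymmetry J)
    (hSJ : Commutes S J) : J ∈ starCommutant S := by
  have hgraph := (commutes_iff_preservesGraph hJ.2).1 hSJ
  exact ⟨hgraph, hJ.1.adjoint_eq.symm ▸ hgraph⟩

theorem adjoint_eq_of_isSelfAdjoint_mul (hJ : IsFundamentalSymmetry J)
    (hJC : IsSelfAdjoint (J * C)) : adjoint C = J * C * J := by
  calc adjoint C = adjoint C * (J * J) := by rw [hJ.2, mul_one]
    _ = adjoint (J * C) * J := by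
      rw [← ContinuousLinearMap.star_eq_adjoint, ← ContinuousLinearMap.star_eq_adjoint, star_mul,
        hJ.1.star_eq, mul_assoc]
    _ = J * C * J := by rw [hJC.adjoint_eq]

theorem cSymmetries_subset_starCommutant (hJ : IsFundamentalSymmetry J) (hSJ : Commutes S J) :
    cSymmetries J S ⊆ starCommutant S := by
  rintro C ⟨hCC, ⟨hJC, -⟩, hSC⟩
  have hC := (commutes_iff_preservesGraph hCC).1 hSC
  have hJ' := (commutes_iff_preservesGraph hJ.2).1 hSJ
  refine ⟨hC, ?_⟩
  rw [adjoint_eq_of_isSelfAdjoint_mul hJ hJC.isSelfAdjoint]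
  exact (hJ'.mul hC).mul hJ'

end Krein

end KreinExt

theorem theorem2p1_general {H : Type*} [NormedAddCommGroup H] [InnerProductSpace ℂ H]
    [CompleteSpace H] (J : H →L[ℂ] H) (hJ : KreinExt.IsFundamentalSymmetry J)
    (S : H →ₗ.[ℂ] H) (hS_dense : Dense (S.domain : Set H)) (hS_symm : S.IsFormalAdjoint S)
    (hSJ : KreinExt.Commutes S J)
    (hSh : ∃ μ : ℂ, 0 ≤ μ.im ∧ KreinExt.CharFunBoundedlyInvertible S μ) :
    ∃ A ∈ KreinExt.upsilonU J S, IsSelfAdjoint A := by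
  obtain ⟨μ, hμ, hSh⟩ := hSh
  obtain ⟨A, hSA, hA, hcomm⟩ := KreinExt.exists_isSelfAdjoint_extension hS_dense hS_symm hμ hSh
  have hJA := hcomm J (KreinExt.fundamentalSymmetry_mem_starCommutant hJ hSJ)
  exact ⟨A, ⟨⟨hSA, KreinExt.isJSelfAdjoint_of_isSelfAdjoint hJ.2 hA hJA⟩, fun C hC =>
    (KreinExt.commutes_iff_preservesGraph hC.1).2
      (hcomm C (KreinExt.cSymmetries_subset_starCommutant hJ hSJ hC))⟩, hA⟩

theorem theorem2p1 {H : Type*} [NormedAddCommGroup H] [InnerProductSpace ℂ H] [CompleteSpace H]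
    (J : H →L[ℂ] H) (hJ : KreinExt.IsFundamentalSymmetry J)
    (S : H →ₗ.[ℂ] H) (hS_dense : Dense (S.domain : Set H)) (hS_closed : S.IsClosed)
    (hS_symm : S.IsFormalAdjoint S) (hSJ : KreinExt.Commutes S J)
    (hSh : ∃ μ : ℂ, 0 < μ.im ∧ KreinExt.CharFunBoundedlyInvertible S μ) :
    (KreinExt.upsilonU J S).Nonempty := by
  obtain ⟨μ, hμ, hμ'⟩ := hSh
  exact (theorem2p1_general J hJ S hS_dense hS_symm hSJ ⟨μ, hμ.le, hμ'⟩).imp fun _ h => h.1
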